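/- Call the members of the smallest set $\mathcal F\subset\mathbb Q$ such that $0\in\mathcal F$, and $(x+y+1)/2\in\mathcal F$ whenever $x,y\in\mathcal F$ and $|y-x|<1$, the fusible numbers. For every $n\in\mathbb N$, among the gaps between consecutive fusible numbers in $\mathcal F\cap[n,\infty)$ (differences $y-x$, where $x<y$ are fusible, $x\ge n$, and no fusible number lies strictly between $x$ and $y$) there is a largest one; denote it by $g(n)$. Then $$g(n)^{-1}\ \ge\ F_{\varepsilon_0}(n-7)\qquad\text{for all integers } n\ge 8.$$ Here $F_\alpha:\mathbb N^+\to\mathbb N^+$ is the Wainer fast-growing hierarchy: $F_0(n)=n+1$; $F_{\alpha+1}(n)=F_\alpha^{(n)}(n)$ ($n$-fold iterate); $F_\alpha(n)=F_{[\alpha]_n}(n)$ for limit $\alpha<\varepsilon_0$; and $F_{\varepsilon_0}(n)=F_{\tau_n}(n)$, where $\tau_0=1$ and $\tau_{n+1}=\omega^{\tau_n}$. For a limit ordinal below $\varepsilon_0$ and $n\ge1$, the canonical sequence is given by $[\omega^\alpha+\beta]_n=\omega^\alpha+[\beta]_n$ for limit $\beta<\omega^{\alpha+1}$; $[\omega^{\alpha+1}]_n=\omega^\alpha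 n$; and $[\omega^\alpha]_n=\omega^{[\alpha]_n}$ for limit $\alpha$. -/

import Mathlib

/-- The fusible numbers: `0` is fusible, and if `x`, `y` are fusible with `|y - x| < 1`, then
`x ∼ y = (x + y + 1) / 2` is fusible. -/
inductive Fusible : ℝ → Prop
  | zero : Fusible 0
  | fuse (x y : ℝ) (hx : Fusible x) (hy : Fusible y) (hxy : |y - x| < 1) :
      Fusible ((x + y + 1) / 2)

/-- The set of all gaps `y - x` between consecutive fusible numbers `x < y` in `[n, ∞)`. -/
def fusibleGaps (n : ℕ) : Set ℝ :=
  {δ | ∃ x y : ℝ, Fusible x ∧ Fusible y ∧ (n : ℝ) ≤ x ∧ x < y ∧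
    (∀ z : ℝ, Fusible z → ¬ (x < z ∧ z < y)) ∧ δ = y - x}

/-- The Wainer hierarchy `F_α`, for (notations of) ordinals `α < ε₀`, at arguments `n ≥ 1`:
* `F_0(n) = n + 1`,
* `F_{α+1}(n) = F_α^{(n)}(n)`,
* `F_α(n) = F_{[α]_n}(n)` for limit `α`,

where `[ω^α + β]_n = ω^α + [β]_n` for limit `β < ω^(α+1)`, `[ω^(α+1)]_n = ω^α n`, and
`[ω^α]_n = ω^([α]_n)` for limit `α`.
Mathlib's `ONote.fundamentalSequence` is the same sequence indexed from `0`, with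
`[ω^(α+1)]_i = ω^α (i+1)`; so its term of index `n - 1` is the `[α]_n` above.
(The value at `n = 0` is a dummy; `F_α` maps positive integers to positive integers.) -/
def wainer : ONote → ℕ → ℕ
  | o =>
    match ONote.fundamentalSequence o, ONote.fundamentalSequence_has_prop o with
    | Sum.inl none, _ => fun n => n + 1
    | Sum.inl (some a), h =>
      have : a < o := by rw [ONote.lt_def, h.1]; exact Order.lt_succ _
      fun n => (wainer a)^[n] n
    | Sum.inr f, h => fun n =>
      have : f (n - 1) < o := (h.2.1 (n - 1)).2.1
      wainer (f (n - 1)) n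
  termination_by o => o

/-- The towers `τ_0 = 1`, `τ_{n+1} = ω ^ τ_n`, as ordinal notations. -/
def omegaTower : ℕ → ONote
  | 0 => 1
  | n + 1 => ONote.oadd (omegaTower n) 1 0

/-- `F_{ε₀}(n) = F_{τ_n}(n)`. -/
def wainerEpsilonZero (n : ℕ) : ℕ :=
  wainer (omegaTower n) n

/-!
Let `m x` be the distance from `x` to the next fusible number. Fusing gives `m x ≤ m (x - d) / 2`
whenever `x - 1 + d` is fusible with `0 < d ≤ 1` (`Near.of_sub`); with `d = m (x - 1)` this lets one
descend from `x` in steps, each of which halves the bound. To avoid infima, `m x ≤ δ` is written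
`Near x δ`, and `m x ≤ m y` is written `Dom x y`.

The core is a descent lemma (`exists_dom_descend`): if `p < a ≤ p + 1` are fusible, `u ≤ (a - p) / 4`,
then `m (4 + a - u) ≤ m (4 + p - v)` for some `0 < v ≤ u / 2`. It holds because `m` is at most
`v / 4` at distance `v` below `2 + a`, hence `O(v ^ 3)` at distance `v` below `3 + a`, so that the
descent below `4 + a` is fine enough to hit a point just below `4 + a - (a - p) / 2 ^ i`, which the
doubling `m (4 + a - y) ≤ m (4 + a - 2 * y)` takes to a point just below `4 + p`. Therefore a
descending chain of fusible numbers `a = a₀ > a₁ > ⋯` with steps `a_i - a_{i+1} ≥ 2⁻ᴺ⁻ⁱ`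
(`Chain`) makes `m` just below `4 + a` exponentially small in its length (`Chain.exists_dom`).
Such chains behave like the Hardy hierarchy: the parameter `N` grows by one in each step.

It remains to find long chains. `Rank o a l e` says that the fusible numbers below `a` follow the
fundamental sequences of the ordinal `o`. Fusing with a fixed number halves all scales and preserves
such patterns, so that if `p < a` then below `1 + a` there are infinitely many copies, at ever
smaller scales, of what is below `1 + p`. This shows on the one hand that `1 + a` has rank `ω ^ o`
if `a` has rank `o` (`Rank.oadd_one`), so that `k + 1` has rank `omegaTower k`, and on the other hand that below `1 + a`
there are chains of length at least `wainer o N` with starting parameter linear in `N`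
(`Rank.chain`). Together they bound `m` on `[k + 7, ∞)` by `2 ^ (- wainerEpsilonZero k)`.

That a largest gap exists follows from `m x → 0` and from the fact that fusible numbers do not
accumulate from above (`exists_gap_right`), so that each `x` has a next fusible number.
-/

open Filter Topology

/-! ### Elementary closure properties -/

theorem Fusible.nonneg {x : ℝ} (hx : Fusible x) : 0 ≤ x := by
  induction hx with
  | zero => exact le_rfl
  | fuse x y _ _ _ ihx ihy => linarith

theorem Fusible.add_half {x : ℝ} (hx : Fusible x) : Fusible (x + 1 / 2) := by
  have h := Fusible.fuse x x hx hx (by simp)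
  convert h using 1
  ring

theorem Fusible.add_one {x : ℝ} (hx : Fusible x) : Fusible (x + 1) := by
  induction hx with
  | zero =>
    convert Fusible.zero.add_half.add_half using 1
    norm_num
  | fuse x y _ _ hxy ihx ihy =>
    convert Fusible.fuse (x + 1) (y + 1) ihx ihy (by simpa using hxy) using 1
    ring

theorem Fusible.add_nat {x : ℝ} (hx : Fusible x) (n : ℕ) : Fusible (x + n) := by
  induction n with
  | zero => simpa using hx
  | succ n ih =>
    convert ih.add_one using 1
    push_cast
    ring

theorem Fusible.add_one_sub_pow {x : ℝ} (hx : Fusible x) (k : ℕ) :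
    Fusible (1 + x - (1 / 2) ^ k) := by
  induction k with
  | zero => simpa using hx
  | succ k ih =>
    have h1 : (0 : ℝ) < (1 / 2) ^ k := by positivity
    have h2 : ((1 : ℝ) / 2) ^ k ≤ 1 := pow_le_one₀ (by norm_num) (by norm_num)
    convert Fusible.fuse x _ hx ih (abs_lt.2 ⟨by linarith, by linarith⟩) using 1
    ring

/-- `Near x δ` says that the half-open interval `(x, x + δ]` contains a fusible number. -/
def Near (x δ : ℝ) : Prop := ∃ z, Fusible z ∧ x < z ∧ z ≤ x + δ

/-- `Dom x y` says that the distance from `x` to the fusible numbers above it is at most the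
distance from `y` to the fusible numbers above it. -/
def Dom (x y : ℝ) : Prop := ∀ δ, Near y δ → Near x δ

theorem Near.mono {x δ ε : ℝ} (h : Near x δ) (hδ : δ ≤ ε) : Near x ε := by
  obtain ⟨z, hz, h1, h2⟩ := h
  exact ⟨z, hz, h1, by linarith⟩

theorem Near.pos {x δ : ℝ} (h : Near x δ) : 0 < δ := by
  obtain ⟨z, _, h1, h2⟩ := h
  linarith

theorem Dom.trans {x y z : ℝ} (h : Dom x y) (h' : Dom y z) : Dom x z := fun δ hδ => h δ (h' δ hδ)

/-- Fusing with a fixed `b` halves distances. If the fusible number found above `t` is too far from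
`b` to be fused with it, then `b + 1` does instead. -/
theorem Near.fuse {b t δ : ℝ} (hb : Fusible b) (h1 : b - 1 ≤ t) (h2 : t < b + 1)
    (h : Near t δ) : Near ((b + t + 1) / 2) (δ / 2) := by
  obtain ⟨z, hz, h3, h4⟩ := h
  rcases lt_or_ge z (b + 1) with h5 | h5
  · exact ⟨(b + z + 1) / 2, Fusible.fuse b z hb hz (abs_lt.2 ⟨by linarith, by linarith⟩),
      by linarith, by linarith⟩
  · exact ⟨b + 1, hb.add_one, by linarith, by linarith⟩

/-- The recursion `m x ≤ m (x - d) / 2` for the distance `m` to the next fusible number, valid for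
every `d` with `x - 1 + d` fusible. -/
theorem Near.of_sub {x d δ : ℝ} (hb : Fusible (x - 1 + d)) (h0 : 0 < d) (h1 : d ≤ 1)
    (h : Near (x - d) δ) : Near x (δ / 2) := by
  have := Near.fuse hb (t := x - d) (by linarith) (by linarith) h
  convert this using 1
  ring

theorem near_half {t : ℝ} (ht : -(1 / 2) ≤ t) : Near t (1 / 2) := by
  rcases lt_or_ge t 0 with h0 | h0
  · exact ⟨0, Fusible.zero, h0, by linarith⟩
  have h1 := Nat.floor_le h0
  have h2 := Nat.lt_floor_add_one t
  have hf : Fusible (⌊t⌋₊ : ℝ) := by simpa using Fusible.zero.add_nat ⌊t⌋₊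
  rcases lt_or_ge t (⌊t⌋₊ + 1 / 2) with h | h
  · exact ⟨_, hf.add_half, h, by linarith⟩
  · exact ⟨_, hf.add_one, h2, by linarith⟩

/-- Two steps of size at most `1 / 2` stay within one unit and divide the distance by `4`. -/
theorem near_quarter_pow {j : ℕ} {t : ℝ} (ht : (j : ℝ) ≤ t) : Near t ((1 / 2) * (1 / 4) ^ j) := by
  induction j generalizing t with
  | zero =>
    push_cast at ht
    simpa using near_half (by linarith)
  | succ j ih =>
    push_cast at ht
    have hj : (0 : ℝ) ≤ j := Nat.cast_nonneg j
    have step : ∀ y δ : ℝ, (j : ℝ) + 1 / 2 ≤ y → (∀ y', y - 1 / 2 ≤ y' → Near y' δ) →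
        Near y (δ / 2) := by
      intro y δ hy h
      obtain ⟨z, hz, h1, h2⟩ := near_half (t := y - 1) (by linarith)
      exact Near.of_sub (d := z - (y - 1)) (by simpa using hz) (by linarith) (by linarith)
        (h _ (by linarith))
    have := step t _ (by linarith) fun y' hy' => step y' _ (by linarith) fun y hy =>
      ih (t := y) (by linarith)
    refine this.mono (le_of_eq ?_)
    rw [pow_succ]
    ring

/-- At distance `v ≤ 1` below `2 + a`, the next fusible number is at distance at most `v / 4`: by
fusing with `1 + a`, the distance `v` may be doubled until it exceeds `1 / 2`. -/
theorem near_two_add_sub {a v : ℝ} (ha : Fusible a) (h0 : 0 < v) (h1 : v ≤ 1) :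
    Near (2 + a - v) (v / 4) := by
  have ha0 := ha.nonneg
  have key : ∀ (n : ℕ) (v : ℝ), (1 / 2) ^ (n + 1) < v → v ≤ (1 / 2) ^ n →
      Near (2 + a - v) (v / 4) := by
    intro n
    induction n with
    | zero =>
      intro v hv hv'
      refine (near_quarter_pow (j := 1) (by push_cast; linarith)).mono ?_
      norm_num at hv ⊢
      linarith
    | succ n ih =>
      intro v hv hv'
      have hn : ((1 : ℝ) / 2) ^ n ≤ 1 := pow_le_one₀ (by norm_num) (by norm_num)
      rw [pow_succ] at hv hv'
      have h0 : 0 < v := lt_trans (by positivity) hv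
      have := Near.of_sub (x := 2 + a - v) (d := v) (by convert ha.add_one using 1; ring) h0
        (by linarith) (δ := 2 * v / 4) (by
          have := ih (2 * v) (by linarith) (by linarith)
          convert this using 1
          ring)
      convert this using 1
      ring
  obtain ⟨n, h2, h3⟩ := exists_nat_pow_near_of_lt_one h0 h1 (by norm_num : (0 : ℝ) < 1 / 2)
    (by norm_num)
  exact key n v h2 h3

/-- Three steps just below `3 + a` at most double the distance `v` to `3 + a`, since by
`near_two_add_sub` each has size at most a quarter of it; they divide the distance to the next
fusible number by `8`. -/
theorem near_three_add_sub {a v : ℝ} (ha : Fusible a) {i : ℕ} (h0 : 0 < v)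
    (h1 : v ≤ (1 / 2) ^ i) : Near (3 + a - v) ((1 / 8) ^ (i + 1)) := by
  have ha0 := ha.nonneg
  induction i generalizing v with
  | zero =>
    refine (near_quarter_pow (j := 1) (by norm_num at h1 ⊢; linarith)).mono ?_
    norm_num
  | succ i ih =>
    have hi : ((1 : ℝ) / 2) ^ i ≤ 1 := pow_le_one₀ (by norm_num) (by norm_num)
    rw [pow_succ] at h1
    have step : ∀ w δ : ℝ, 0 < w → w ≤ 1 →
        (∀ w', w ≤ w' → w' ≤ 5 / 4 * w → Near (3 + a - w') δ) → Near (3 + a - w) (δ / 2) := by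
      intro w δ hw hw' h
      obtain ⟨z, hz, h2, h3⟩ := near_two_add_sub ha hw hw'
      refine Near.of_sub (d := z - (2 + a - w)) (by convert hz using 1; ring) (by linarith)
        (by linarith) ?_
      convert h (w + (z - (2 + a - w))) (by linarith) (by linarith) using 1
      ring
    have := step v _ h0 (by linarith) fun v₁ h2 h3 =>
      step v₁ _ (by linarith) (by linarith) fun v₂ h4 h5 =>
      step v₂ _ (by linarith) (by linarith) fun v₃ h6 h7 =>
      ih (v := v₃) (by linarith) (by linarith)
    refine this.mono (le_of_eq ?_)
    rw [pow_succ _ (i + 1)]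
    ring

theorem near_three_add_sub_cube {a v w : ℝ} (ha : Fusible a) (h0 : 0 < v) (hvw : v ≤ w)
    (hw : w ≤ 1) : Near (3 + a - v) (w ^ 3) := by
  obtain ⟨n, h2, h3⟩ := exists_nat_pow_near_of_lt_one (h0.trans_le hvw) hw
    (by norm_num : (0 : ℝ) < 1 / 2) (by norm_num)
  refine (near_three_add_sub ha h0 (hvw.trans h3)).mono ?_
  calc ((1 : ℝ) / 8) ^ (n + 1) = ((1 / 2) ^ (n + 1)) ^ 3 := by
        rw [← pow_mul, mul_comm, pow_mul]; norm_num
    _ ≤ w ^ 3 := by gcongr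

/-- Descending from `x` by steps of size at most `δ` lands within `δ` below any given target `r`. -/
theorem exists_dom_sub {x r δ : ℝ} (hrx : r ≤ x) (hδ : δ ≤ 1)
    (h : ∀ t, r - 1 ≤ t → t ≤ x - 1 → Near t δ) :
    ∃ v, 0 < v ∧ v ≤ δ ∧ Dom x (r - v) := by
  by_contra! hcon
  set S : Set ℝ := {y | r ≤ y ∧ y ≤ x ∧ Dom x y} with hS
  have hne : S.Nonempty := ⟨x, hrx, le_rfl, fun _ h => h⟩
  have hbdd : BddBelow S := ⟨r, fun y hy => hy.1⟩
  have hr : r ≤ sInf S := le_csInf hne fun y hy => hy.1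
  have hx : sInf S ≤ x := csInf_le hbdd ⟨hrx, le_rfl, fun _ h => h⟩
  -- One fusible number above `sInf S - 1` serves for a step from every `y ∈ S` close to `sInf S`,
  -- and that step goes below `sInf S`.
  obtain ⟨b, hb, h1, h2⟩ := h (sInf S - 1) (by linarith) (by linarith)
  obtain ⟨y, hy, hyb⟩ := exists_lt_of_csInf_lt hne
    (show sInf S < (sInf S + b + 1) / 2 by linarith)
  have hy0 : sInf S ≤ y := csInf_le hbdd hy
  have hd : Dom x (2 * y - 1 - b) := by
    refine hy.2.2.trans fun ε hε => ?_
    refine (Near.of_sub (x := y) (d := b - (y - 1)) (by simpa using hb) (by linarith)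
      (by linarith) (δ := ε) (by convert hε using 1; ring)).mono ?_
    linarith [hε.pos]
  rcases lt_or_ge (2 * y - 1 - b) r with h3 | h3
  · exact hcon (r - (2 * y - 1 - b)) (by linarith) (by linarith) (by simpa using hd)
  · have := csInf_le hbdd (show 2 * y - 1 - b ∈ S from ⟨h3, by linarith [hy.2.1], hd⟩)
    linarith

theorem dom_add_sub_pow_mul {a y : ℝ} (ha : Fusible a) (hy : 0 < y) (i : ℕ)
    (h : 2 ^ i * y ≤ 2) : Dom (4 + a - y) (4 + a - 2 ^ i * y) := by
  induction i with
  | zero => intro δ hδ; simpa using hδ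
  | succ i ih =>
    rw [pow_succ] at h
    have hp : 0 < 2 ^ i * y := by positivity
    refine (ih (by linarith)).trans fun ε hε => ?_
    refine (Near.of_sub (x := 4 + a - 2 ^ i * y) (d := 2 ^ i * y) ?_ hp (by linarith) (δ := ε)
      ?_).mono (by linarith [hε.pos])
    · convert ha.add_nat 3 using 1
      push_cast
      ring
    · convert hε using 1
      ring

/-- The descent step: from distance `u` below `4 + a` one gets to distance at most `u / 2` below
`4 + p`, for every fusible `p < a` such that `u` is small compared with `a - p`. -/
theorem exists_dom_descend {a p u : ℝ} (ha : Fusible a) (hap : a - p ≤ 1)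
    (hu : 0 < u) (hug : u ≤ (a - p) / 4) :
    ∃ v, 0 < v ∧ v ≤ u / 2 ∧ Dom (4 + a - u) (4 + p - v) := by
  set g := a - p with hg
  have hg0 : 0 < g := by linarith
  obtain ⟨i, h1, h2⟩ := exists_nat_pow_near_of_lt_one (div_pos hu hg0)
    ((div_le_one hg0).2 (by linarith)) (by norm_num : (0 : ℝ) < 1 / 2) (by norm_num)
  have hi : 2 ≤ i := by
    by_contra! hlt
    have h3 : ((1 : ℝ) / 2) ^ 2 ≤ (1 / 2) ^ (i + 1) :=
      pow_le_pow_of_le_one (by norm_num) (by norm_num) (by omega)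
    have h4 : u / g ≤ 1 / 4 := (div_le_iff₀ hg0).2 (by linarith)
    norm_num at h3
    linarith
  have hi4 : ((1 : ℝ) / 2) ^ i ≤ 1 / 4 :=
    (pow_le_pow_of_le_one (by norm_num) (by norm_num) hi).trans (by norm_num)
  have hi0 : (0 : ℝ) < (1 / 2) ^ i := by positivity
  rw [lt_div_iff₀ hg0, pow_succ] at h1
  rw [div_le_iff₀ hg0] at h2
  set w := (1 / 2) ^ i * g with hw
  have hw0 : 0 < w := by positivity
  have hw4 : w ≤ 1 / 4 := by nlinarith
  have hw3 : w ^ 3 ≤ 1 := pow_le_one₀ hw0.le (by linarith)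
  obtain ⟨v, hv0, hv, hdom⟩ := exists_dom_sub (x := 4 + a - u) (r := 4 + a - w) (δ := w ^ 3)
    (by linarith) hw3 (by
      intro t ht ht'
      have := near_three_add_sub_cube ha (v := 3 + a - t) (w := w) (by linarith) (by linarith)
        (by linarith)
      simpa using this)
  have hp : (2 : ℝ) ^ i * (1 / 2) ^ i = 1 := by rw [← mul_pow]; norm_num
  have hpw : 2 ^ i * w = g := by rw [hw, ← mul_assoc, hp, one_mul]
  have hv2 : 2 ^ i * v ≤ w / 4 := by
    calc 2 ^ i * v ≤ 2 ^ i * w ^ 3 := by gcongr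
      _ = (g * w) * w := by rw [← hpw]; ring
      _ ≤ (1 * (1 / 4)) * w := by gcongr
      _ = _ := by ring
  have hv3 : 2 ^ i * v ≤ u / 2 := by linarith
  refine ⟨2 ^ i * v, by positivity, hv3, hdom.trans ?_⟩
  have := dom_add_sub_pow_mul ha (y := w + v) (by linarith) i (by rw [mul_add, hpw]; linarith)
  convert this using 1
  · ring
  · rw [mul_add, hpw, hg]; ring

/-! ### Descending chains of fusible numbers -/

/-- `Chain a N q M`: there is a descending chain of fusible numbers from `a` to `q` whose successive
steps have lengths at least `2⁻ᴺ`, `2⁻ᴺ⁻¹`, `2⁻ᴺ⁻²`, … (and at most `1`), and which has at least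
`M - N` steps. -/
inductive Chain : ℝ → ℕ → ℝ → ℕ → Prop
  | refl {a : ℝ} {N M : ℕ} (ha : Fusible a) (h : M ≤ N) : Chain a N a M
  | step {a p q : ℝ} {N M : ℕ} (ha : Fusible a) (h : p ≤ a - (1 / 2) ^ N) (h1 : a - 1 ≤ p)
      (hc : Chain p (N + 1) q M) : Chain a N q M

namespace Chain

theorem fusible_left {a q : ℝ} {N M : ℕ} (h : Chain a N q M) : Fusible a := by
  cases h <;> assumption

theorem fusible_right {a q : ℝ} {N M : ℕ} (h : Chain a N q M) : Fusible q := by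
  induction h <;> assumption

theorem le {a q : ℝ} {N M : ℕ} (h : Chain a N q M) : q ≤ a := by
  induction h with
  | refl => exact le_rfl
  | @step a p q N M _ h _ _ ih =>
    have : (0 : ℝ) < (1 / 2) ^ N := by positivity
    linarith

theorem mono {a q : ℝ} {N M N' M' : ℕ} (h : Chain a N q M) (hN : N ≤ N') (hM : M' ≤ M) :
    Chain a N' q M' := by
  induction h generalizing N' with
  | refl ha h => exact refl ha (by omega)
  | @step a p q N M ha h h1 _ ih =>
    have : ((1 : ℝ) / 2) ^ N' ≤ (1 / 2) ^ N :=
      pow_le_pow_of_le_one (by norm_num) (by norm_num) hN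
    exact step ha (by linarith) h1 (ih (by omega) hM)

theorem trans {a p q : ℝ} {N M K : ℕ} (h : Chain a N p M) (h' : Chain p M q K) :
    Chain a N q K := by
  induction h with
  | refl ha h => exact h'.mono h le_rfl
  | step ha h h1 _ ih => exact step ha h h1 (ih h')

/-- The end point of a chain that has at least one step can be lowered. -/
theorem lower {a p p' : ℝ} {N M : ℕ} (h : Chain a N p M) (hNM : N < M) (hp' : Fusible p')
    (hpp : p' ≤ p) (h1 : a - 1 ≤ p') : Chain a N p' M := by
  induction h with
  | refl ha h => omega
  | @step a r q N M ha h h2 hc ih =>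
    have hq := hc.le
    rcases Nat.lt_or_ge (N + 1) M with h3 | h3
    · have : (0 : ℝ) < (1 / 2) ^ N := by positivity
      exact step ha h h2 (ih h3 hpp (by linarith))
    · exact step ha (by linarith) h1 (refl hp' h3)

/-- Fusing with a fixed `b` maps chains to chains, with steps half as long. -/
theorem fuse {a q b : ℝ} {N M : ℕ} (h : Chain a N q M) (hb : Fusible b) (ha : a < b + 1)
    (hq : b - 1 < q) : Chain ((b + a + 1) / 2) (N + 1) ((b + q + 1) / 2) (M + 1) := by
  induction h with
  | refl hf h =>
    exact refl (Fusible.fuse _ _ hb hf (abs_lt.2 ⟨by linarith, by linarith⟩)) (by omega)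
  | @step a p q N M hf h h1 hc ih =>
    have : (0 : ℝ) < (1 / 2) ^ N := by positivity
    have hle := hc.le
    refine step (Fusible.fuse _ _ hb hf (abs_lt.2 ⟨by linarith, by linarith⟩)) ?_ (by linarith)
      (ih (by linarith) hq)
    rw [pow_succ]
    linarith

/-- Just below `1 + b` there is the chain `1 + b - 2⁻ʲ`, whose steps double in length. -/
theorem doubling {b : ℝ} (hb : Fusible b) (x k : ℕ) :
    Chain (1 + b) (x + k) (1 + b - (1 / 2) ^ k) (2 * x + 1 + k) := by
  have key : ∀ y N : ℕ, y + k ≤ N →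
      Chain (1 + b - (1 / 2) ^ (y + k)) N (1 + b - (1 / 2) ^ k) (N + y) := by
    intro y
    induction y with
    | zero =>
      intro N _
      simpa using refl (hb.add_one_sub_pow k) le_rfl
    | succ y ih =>
      intro N hN
      have h1 : ((1 : ℝ) / 2) ^ N ≤ (1 / 2) ^ (y + 1 + k) :=
        pow_le_pow_of_le_one (by norm_num) (by norm_num) hN
      have h2 : ((1 : ℝ) / 2) ^ (y + 1 + k) = (1 / 2) ^ (y + k) / 2 := by ring
      have h3 : ((1 : ℝ) / 2) ^ (y + k) ≤ 1 := pow_le_one₀ (by norm_num) (by norm_num)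
      have h4 : (0 : ℝ) < (1 / 2) ^ (y + k) := by positivity
      refine step (hb.add_one_sub_pow _) (p := 1 + b - (1 / 2) ^ (y + k)) (by linarith)
        (by linarith) ((ih (N + 1) (by omega)).mono le_rfl (by omega))
  have h3 : ((1 : ℝ) / 2) ^ (x + k) ≤ 1 := pow_le_one₀ (by norm_num) (by norm_num)
  refine step (p := 1 + b - (1 / 2) ^ (x + k)) ?_ le_rfl (by linarith)
    ((key x _ (by omega)).mono le_rfl (by omega))
  convert hb.add_one using 1
  ring

/-- The descent step `exists_dom_descend`, iterated along a chain. Each step halves the distance, so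
a chain with many steps ends very close below the fusible number `4 + q`. -/
theorem exists_dom {a q u : ℝ} {N M : ℕ} (h : Chain a N q M) (hu : 0 < u)
    (huN : u ≤ (1 / 2) ^ (N + 2)) :
    ∃ v, 0 < v ∧ v ≤ (1 / 2) ^ (M + 2) ∧ Dom (4 + a - u) (4 + q - v) := by
  induction h generalizing u with
  | refl ha h =>
    exact ⟨u, hu, huN.trans (pow_le_pow_of_le_one (by norm_num) (by norm_num) (by omega)),
      fun _ h => h⟩
  | @step a p q N M ha h h1 _ ih =>
    obtain ⟨v, hv, hvu, hd⟩ := exists_dom_descend (p := p) ha (by linarith) hu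
      (huN.trans (by rw [pow_add]; linarith))
    obtain ⟨w, hw, hwM, hd'⟩ := ih hv (hvu.trans (by
      rw [show N + 1 + 2 = N + 2 + 1 by ring, pow_succ]
      linarith))
    exact ⟨w, hw, hwM, hd.trans hd'⟩

end Chain

/-! ### Fundamental sequences and the Wainer hierarchy -/

theorem fundamentalSequence_eq_inl_none {o : ONote}
    (h : o.fundamentalSequence = Sum.inl none) : o = 0 := by
  have := ONote.fundamentalSequence_has_prop o
  rwa [h] at this

theorem fundamentalSequence_ne_inl_none_of_inr {o : ONote} {f : ℕ → ONote}
    (h : o.fundamentalSequence = Sum.inr f) (i : ℕ) :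
    (f i).fundamentalSequence ≠ Sum.inl none := by
  intro h0
  have hf := fundamentalSequence_eq_inl_none h0
  cases o with
  | zero => simp [ONote.fundamentalSequence] at h
  | oadd a m b =>
    rw [ONote.fundamentalSequence] at h
    split at h
    · cases h; cases hf
    · cases h
    · split at h <;> cases h <;> cases hf

theorem fundamentalSequence_oadd_one_of_succ {α β : ONote}
    (h : α.fundamentalSequence = Sum.inl (some β)) :
    (ONote.oadd α 1 0).fundamentalSequence = Sum.inr fun i => ONote.oadd β i.succPNat 0 := by
  change (ONote.oadd α (Nat.succPNat 0) 0).fundamentalSequence = _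
  simp [ONote.fundamentalSequence, h]

theorem fundamentalSequence_oadd_one_of_limit {α : ONote} {f : ℕ → ONote}
    (h : α.fundamentalSequence = Sum.inr f) :
    (ONote.oadd α 1 0).fundamentalSequence = Sum.inr fun i => ONote.oadd (f i) 1 0 := by
  change (ONote.oadd α (Nat.succPNat 0) 0).fundamentalSequence = _
  simp [ONote.fundamentalSequence, h]

theorem fundamentalSequence_oadd_succ {α : ONote} (m : ℕ) {f : ℕ → ONote}
    (h : (ONote.oadd α 1 0).fundamentalSequence = Sum.inr f) :
    (ONote.oadd α (m + 1).succPNat 0).fundamentalSequence =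
      Sum.inr fun i => ONote.oadd α m.succPNat (f i) := by
  rcases hα : α.fundamentalSequence with (_ | β) | g
  · obtain rfl := fundamentalSequence_eq_inl_none hα
    cases h
  · rw [fundamentalSequence_oadd_one_of_succ hα] at h
    cases h
    simp [ONote.fundamentalSequence, hα]
  · rw [fundamentalSequence_oadd_one_of_limit hα] at h
    cases h
    simp [ONote.fundamentalSequence, hα]

theorem wainer_eq {o : ONote} {x} (e : o.fundamentalSequence = x) :
    wainer o =
      match
        (motive := (x : Option ONote ⊕ (ℕ → ONote)) → ONote.FundamentalSequenceProp o x → ℕ → ℕ)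
        x, e ▸ ONote.fundamentalSequence_has_prop o with
      | Sum.inl none, _ => fun n => n + 1
      | Sum.inl (some a), _ => fun n => (wainer a)^[n] n
      | Sum.inr f, _ => fun n => wainer (f (n - 1)) n := by
  subst x
  rw [wainer]

theorem wainer_zero {o : ONote} (h : o.fundamentalSequence = Sum.inl none) (n : ℕ) :
    wainer o n = n + 1 := by
  rw [wainer_eq h]

theorem wainer_succ {o a : ONote} (h : o.fundamentalSequence = Sum.inl (some a)) (n : ℕ) :
    wainer o n = (wainer a)^[n] n := by
  rw [wainer_eq h]

theorem wainer_limit {o : ONote} {f : ℕ → ONote} (h : o.fundamentalSequence = Sum.inr f)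
    (n : ℕ) : wainer o n = wainer (f (n - 1)) n := by
  rw [wainer_eq h]

theorem lt_wainer (o : ONote) {n : ℕ} (hn : 1 ≤ n) : n < wainer o n := by
  induction o using (WellFoundedRelation.wf (α := ONote)).induction generalizing n with
  | h o ih =>
    have hprop := ONote.fundamentalSequence_has_prop o
    rcases ho : o.fundamentalSequence with (_ | o') | f <;> rw [ho] at hprop
    · rw [wainer_zero ho]
      omega
    · have hlt : o' < o := by rw [ONote.lt_def, hprop.1]; exact Order.lt_succ _
      have key : ∀ k, n + k ≤ (wainer o')^[k] n := by
        intro k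
        induction k with
        | zero => exact le_rfl
        | succ k hk =>
          rw [Function.iterate_succ_apply']
          have := ih o' hlt (n := (wainer o')^[k] n) (by omega)
          omega
      have := key n
      rw [wainer_succ ho]
      omega
    · rw [wainer_limit ho]
      exact ih _ (hprop.2.1 _).2.1 hn

/-! ### Fusible numbers of given rank -/

/-- `Rank o a l e`: just below the fusible number `a`, at all scales `2⁻ˡ'` with `l' ≥ l`, the
fusible numbers contain a pattern of type `o`, following the fundamental sequences of `o` and the
smaller ordinals that they reach.
* If `o` is a successor, then there is a fusible `p < a` whose rank is the predecessor of `o`, at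
  scale `a - p` (rounded down to a power of `2`).
* If `o` is a limit, then at each scale `2⁻ˡ'` and for each `i` there is a fusible `p` whose rank is
  the `i`-th term of the fundamental sequence of `o`, with `a - p` between `2⁻ˡ' / 2ⁱ⁺²` and
  (slightly less than) `2⁻ˡ'`, at scale `2⁻ˡ' / 2ⁱ⁺²`.

All fusible numbers involved lie in `[a - e, a]`. -/
inductive Rank : ONote → ℝ → ℕ → ℝ → Prop
  | zero {o : ONote} {a : ℝ} {l : ℕ} {e : ℝ} (ho : o.fundamentalSequence = Sum.inl none)
      (ha : Fusible a) (he : 0 ≤ e) : Rank o a l e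
  | succ {o o' : ONote} {a p : ℝ} {l l' : ℕ} {e e' : ℝ}
      (ho : o.fundamentalSequence = Sum.inl (some o')) (ha : Fusible a) (h1 : 1 ≤ l')
      (hl : l' ≤ l) (hp : Rank o' p l' e') (h2 : (1 / 2) ^ l' ≤ a - p)
      (h3 : a - p < 2 * (1 / 2) ^ l') (he : e' + (a - p) ≤ e) : Rank o a l e
  | limit {o : ONote} {f : ℕ → ONote} {a : ℝ} {l : ℕ} {e : ℝ} (p e' : ℕ → ℕ → ℝ)
      (ho : o.fundamentalSequence = Sum.inr f) (ha : Fusible a)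
      (hp : ∀ l' i, l ≤ l' → Rank (f i) (p l' i) (l' + i + 2) (e' l' i))
      (h2 : ∀ l' i, l ≤ l' → (1 / 2) ^ (l' + i + 2) ≤ a - p l' i)
      (h3 : ∀ l' i, l ≤ l' → a - p l' i ≤ (1 / 2) ^ l' - (1 / 2) ^ (l' + i + 2))
      (he : ∀ l' i, l ≤ l' → e' l' i + (a - p l' i) ≤ e) : Rank o a l e

theorem two_mul_half_pow_le {x : ℕ} (hx : 1 ≤ x) : 2 * ((1 : ℝ) / 2) ^ x ≤ 1 := by
  have : ((1 : ℝ) / 2) ^ x ≤ (1 / 2) ^ 1 :=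
    pow_le_pow_of_le_one (by norm_num) (by norm_num) hx
  linarith

theorem le_of_half_pow_lt {k m : ℕ} (h : ((1 : ℝ) / 2) ^ m < 2 * (1 / 2) ^ k) : k ≤ m := by
  by_contra! hlt
  have : ((1 : ℝ) / 2) ^ k ≤ (1 / 2) ^ (m + 1) :=
    pow_le_pow_of_le_one (by norm_num) (by norm_num) hlt
  rw [pow_succ] at this
  linarith

theorem exists_half_pow_near {d : ℝ} (h0 : 0 < d) (h1 : d < 1) :
    ∃ k : ℕ, (1 / 2) ^ k ≤ d ∧ d < 2 * (1 / 2) ^ k := by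
  classical
  have hex : ∃ k : ℕ, ((1 : ℝ) / 2) ^ k ≤ d :=
    (exists_pow_lt_of_lt_one h0 (by norm_num)).imp fun _ h => h.le
  refine ⟨Nat.find hex, Nat.find_spec hex, ?_⟩
  obtain ⟨k, hk⟩ : ∃ k, Nat.find hex = k + 1 := Nat.exists_eq_succ_of_ne_zero fun h => by
    have := Nat.find_spec hex
    rw [h, pow_zero] at this
    linarith
  have := Nat.find_min hex (m := k) (by omega)
  rw [hk, pow_succ]
  linarith

namespace Rank

theorem fusible {o : ONote} {a e : ℝ} {l : ℕ} (h : Rank o a l e) : Fusible a := by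
  cases h <;> assumption

theorem nonneg {o : ONote} {a e : ℝ} {l : ℕ} (h : Rank o a l e) : 0 ≤ e := by
  induction h with
  | zero _ _ he => exact he
  | @succ o o' a p l l' e e' _ _ _ _ _ h2 _ he ih =>
    have : (0 : ℝ) < (1 / 2) ^ l' := by positivity
    linarith
  | @limit o f a l e p e' _ _ _ h2 _ he ih =>
    have : (0 : ℝ) < (1 / 2) ^ (l + 0 + 2) := by positivity
    linarith [ih l 0 le_rfl, h2 l 0 le_rfl, he l 0 le_rfl]

theorem mono {o : ONote} {a e E : ℝ} {l L : ℕ} (h : Rank o a l e) (hl : l ≤ L) (he : e ≤ E) :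
    Rank o a L E := by
  cases h with
  | zero ho ha h => exact zero ho ha (h.trans he)
  | succ ho ha h1 hl' hp h2 h3 h => exact succ ho ha h1 (hl'.trans hl) hp h2 h3 (h.trans he)
  | limit p e' ho ha hp h2 h3 h =>
    exact limit p e' ho ha (fun l' i hl' => hp l' i (hl.trans hl'))
      (fun l' i hl' => h2 l' i (hl.trans hl')) (fun l' i hl' => h3 l' i (hl.trans hl'))
      (fun l' i hl' => (h l' i (hl.trans hl')).trans he)

/-- Fusing with a fixed `b` preserves ranks and halves the scale. -/
theorem fuse {o : ONote} {a e b : ℝ} {l : ℕ} (h : Rank o a l e) (hb : Fusible b)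
    (h1 : b - 1 < a - e) (h2 : a < b + 1) : Rank o ((b + a + 1) / 2) (l + 1) (e / 2) := by
  have hf : ∀ {a e}, Fusible a → 0 ≤ e → b - 1 < a - e → a < b + 1 → Fusible ((b + a + 1) / 2) :=
    fun ha he h1 h2 => Fusible.fuse _ _ hb ha (abs_lt.2 ⟨by linarith, by linarith⟩)
  have hn := h.nonneg
  induction h with
  | zero ho ha he => exact zero ho (hf ha he h1 h2) (by linarith)
  | @succ o o' a p l l' e e' ho ha h1' hl hp h3 h4 he ih =>
    have h0 : (0 : ℝ) < (1 / 2) ^ l' := by positivity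
    have := ih (by linarith) (by linarith) hp.nonneg
    refine succ ho (hf ha hn h1 h2) (by omega) (by omega) this ?_ ?_ (by linarith) <;>
    · rw [pow_succ]
      linarith
  | @limit o f a l e p e' ho ha hp h3 h4 he ih =>
    refine limit (fun l' i => (b + p (l' - 1) i + 1) / 2) (fun l' i => e' (l' - 1) i / 2) ho
      (hf ha hn h1 h2) ?_ ?_ ?_ ?_
    all_goals
      intro l' i hl'
      obtain ⟨k, rfl⟩ : ∃ k, l' = k + 1 := ⟨l' - 1, by omega⟩
      have hk : l ≤ k := by omega
      simp only [Nat.add_sub_cancel]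
      have h0 : (0 : ℝ) < (1 / 2) ^ (k + i + 2) := by positivity
      have h3' := h3 k i hk
      have h4' := h4 k i hk
      have he' := he k i hk
    · rw [show k + 1 + i + 2 = k + i + 2 + 1 by ring]
      exact ih k i hk (by linarith) (by linarith) (hp k i hk).nonneg
    · rw [show k + 1 + i + 2 = k + i + 2 + 1 by ring, pow_succ]
      linarith
    · rw [show k + 1 + i + 2 = k + i + 2 + 1 by ring, pow_succ _ k, pow_succ _ (k + i + 2)]
      linarith
    · linarith

/-- Two patterns on top of each other: if `a` has nonzero rank `δ`, witnessed above `a'`, and `a'`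
has rank `ω ^ α * m`, then `a` has rank `ω ^ α * m + δ`. The lowest point of the upper pattern is
replaced by `a'`. -/
theorem add {α δ : ONote} {m : ℕ+} {a' a e₀ e : ℝ} {x l : ℕ} (hx : 1 ≤ x)
    (h' : Rank (ONote.oadd α m 0) a' x e₀) (h : Rank δ a l e)
    (hδ : δ.fundamentalSequence ≠ Sum.inl none) (he : e ≤ a - a')
    (hax : a - a' < 2 * (1 / 2) ^ x) : Rank (ONote.oadd α m δ) a l (e₀ + (a - a')) := by
  induction h with
  | zero ho => exact absurd ho hδ
  | @succ o o' a p l l' e e' ho ha h1 hl hp h2 h3 hee ih =>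
    have hs : (ONote.oadd α m o).fundamentalSequence = Sum.inl (some (ONote.oadd α m o')) := by
      rw [ONote.fundamentalSequence, ho]
    have h0 : (0 : ℝ) < (1 / 2) ^ l' := by positivity
    have hp0 := hp.nonneg
    by_cases ho' : o'.fundamentalSequence = Sum.inl none
    · obtain rfl := fundamentalSequence_eq_inl_none ho'
      obtain ⟨k, hk1, hk2⟩ := exists_half_pow_near (d := a - a') (by linarith)
        (hax.trans_le (two_mul_half_pow_le hx))
      have hxk := le_of_half_pow_lt (hk1.trans_lt hax)
      have hkl := le_of_half_pow_lt (show ((1 : ℝ) / 2) ^ l' < 2 * (1 / 2) ^ k by linarith)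
      exact succ hs ha (hx.trans hxk) (hkl.trans hl) (h'.mono hxk le_rfl) hk1 hk2 le_rfl
    · exact succ hs ha h1 hl (ih ho' (by linarith) (by linarith)) h2 h3 (by linarith)
  | @limit o f a l e p e' ho ha hp h2 h3 hee ih =>
    have hs : (ONote.oadd α m o).fundamentalSequence =
        Sum.inr fun i => ONote.oadd α m (f i) := by
      rw [ONote.fundamentalSequence, ho]
    refine limit p (fun l' i => e₀ + (p l' i - a')) hs ha (fun l' i hl' => ?_) h2 h3
      (fun l' i hl' => by linarith)
    have h0 : (0 : ℝ) < (1 / 2) ^ (l' + i + 2) := by positivity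
    exact ih l' i hl' (fundamentalSequence_ne_inl_none_of_inr ho i)
      (by linarith [hee l' i hl']) (by linarith [h2 l' i hl'])

/-- The case `δ = ω ^ α` of `Rank.add`, where the sum is `ω ^ α * (m + 1)`. -/
theorem add_single {α : ONote} {m : ℕ} {a' a e₀ e : ℝ} {x l : ℕ} (hx : 1 ≤ x)
    (h' : Rank (ONote.oadd α m.succPNat 0) a' x e₀) (h : Rank (ONote.oadd α 1 0) a l e)
    (he : e ≤ a - a') (hax : a - a' < 2 * (1 / 2) ^ x) :
    Rank (ONote.oadd α (m + 1).succPNat 0) a l (e₀ + (a - a')) := by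
  cases h with
  | zero ho =>
    have := fundamentalSequence_eq_inl_none ho
    cases this
  | @succ _ o' _ p _ l' _ e' ho ha h1 hl hp h2 h3 hee =>
    have hα : α = 0 := by
      rcases hα : α.fundamentalSequence with (_ | β) | f
      · exact fundamentalSequence_eq_inl_none hα
      · rw [fundamentalSequence_oadd_one_of_succ hα] at ho
        cases ho
      · rw [fundamentalSequence_oadd_one_of_limit hα] at ho
        cases ho
    subst hα
    have h0 : (0 : ℝ) < (1 / 2) ^ l' := by positivity
    have hp0 := hp.nonneg
    obtain ⟨k, hk1, hk2⟩ := exists_half_pow_near (d := a - a') (by linarith)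
      (hax.trans_le (two_mul_half_pow_le hx))
    have hxk := le_of_half_pow_lt (hk1.trans_lt hax)
    have hkl := le_of_half_pow_lt (show ((1 : ℝ) / 2) ^ l' < 2 * (1 / 2) ^ k by linarith)
    exact succ rfl ha (hx.trans hxk) (hkl.trans hl) (h'.mono hxk le_rfl) hk1 hk2 le_rfl
  | limit p e' ho ha hp h2 h3 hee =>
    refine limit p (fun l' i => e₀ + (p l' i - a')) (fundamentalSequence_oadd_succ m ho) ha
      (fun l' i hl' => ?_) h2 h3 (fun l' i hl' => by linarith)
    have h0 : (0 : ℝ) < (1 / 2) ^ (l' + i + 2) := by positivity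
    exact add hx h' (hp l' i hl') (fundamentalSequence_ne_inl_none_of_inr ho i)
      (by linarith [hee l' i hl']) (by linarith [h2 l' i hl'])

/-- If `α = β + 1`, witnessed by `p < a`, then the images of `1 + p` under repeated fusing with `a`
converge to `1 + a`, and consecutive ones are separated by patterns of type `ω ^ β`. -/
theorem oadd_one {α : ONote} {a e : ℝ} {l : ℕ} (hl : 1 ≤ l) (h : Rank α a l e) :
    Rank (ONote.oadd α 1 0) (1 + a) l ((1 / 2) ^ l) := by
  induction h with
  | @zero o a l e ho ha he =>
    obtain rfl := fundamentalSequence_eq_inl_none ho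
    have h0 : (0 : ℝ) < (1 / 2) ^ l := by positivity
    exact succ (o' := 0) (p := 1 + a - (1 / 2) ^ l) (e' := 0) rfl
      (by simpa [add_comm] using ha.add_one) hl le_rfl
      (zero rfl (ha.add_one_sub_pow l) le_rfl) (by linarith) (by linarith) (by linarith)
  | @succ o β a p l l' e e' ho ha h1 hl' hp h2 h3 he ih =>
    have hpow : ∀ n, (0 : ℝ) < (1 / 2) ^ n := fun n => by positivity
    have hpow1 : ∀ n, ((1 : ℝ) / 2) ^ n ≤ 1 := fun n => pow_le_one₀ (by norm_num) (by norm_num)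
    set g := a - p with hg
    have hg1 : g < 1 := h3.trans_le (two_mul_half_pow_le h1)
    have hg0 : 0 < g := (hpow l').trans_le h2
    set A : ℕ → ℝ := fun j => 1 + a - g * (1 / 2) ^ j with hA
    have hgl : ∀ j, (1 / 2) ^ (l' + j) ≤ g * (1 / 2) ^ j := fun j => by
      rw [pow_add]
      exact mul_le_mul_of_nonneg_right h2 (hpow j).le
    have hgl' : ∀ j, g * (1 / 2) ^ j < 2 * (1 / 2) ^ (l' + j) := fun j => by
      rw [pow_add, ← mul_assoc]
      exact mul_lt_mul_of_pos_right h3 (hpow j)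
    have hAs : ∀ j, A (j + 1) - A j = g * (1 / 2) ^ (j + 1) := fun j => by
      simp only [hA, pow_succ]
      ring
    have hR : ∀ j, Rank (ONote.oadd β 1 0) (A j) (l' + j) ((1 / 2) ^ (l' + j)) := by
      intro j
      induction j with
      | zero =>
        have hA0 : A 0 = 1 + p := by simp only [hA, hg]; ring
        rw [hA0]
        exact ih h1
      | succ j ihj =>
        have h4 : g * (1 / 2) ^ j ≤ g := mul_le_of_le_one_right hg0.le (hpow1 j)
        have h5 := hpow1 (l' + j)
        have h6 : 0 < g * (1 / 2) ^ j := mul_pos hg0 (hpow j)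
        have hAj : A (j + 1) = (a + A j + 1) / 2 := by
          simp only [hA, pow_succ]
          ring
        rw [hAj, ← add_assoc, pow_succ, mul_one_div]
        exact ihj.fuse ha (by simp only [hA]; linarith) (by simp only [hA]; linarith)
    -- The patterns of type `ω ^ β` between `A K` and `A (K + m + 1)`, put together.
    have hM : ∀ K m : ℕ, Rank (ONote.oadd β m.succPNat 0) (A (K + m + 1)) (l' + (K + m + 1))
        (A (K + m + 1) - A K) := by
      intro K m
      induction m with
      | zero => exact (hR (K + 1)).mono le_rfl ((hgl (K + 1)).trans_eq (hAs K).symm)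
      | succ m ihm =>
        have h4 := hAs (K + m + 1)
        have h5 := hgl' (K + m + 1 + 1)
        have h6 : ((1 : ℝ) / 2) ^ (l' + (K + m + 1 + 1)) ≤ (1 / 2) ^ (l' + (K + m + 1)) :=
          pow_le_pow_of_le_one (by norm_num) (by norm_num) (by omega)
        have := add_single (by omega) ihm (hR (K + m + 1 + 1))
          ((hgl _).trans_eq h4.symm) (by linarith)
        exact this.mono le_rfl (le_of_eq (by ring_nf))
    refine limit (fun L i => A (L - l' + 1 + i + 1))
      (fun L i => A (L - l' + 1 + i + 1) - A (L - l' + 1))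
      (fundamentalSequence_oadd_one_of_succ ho) (by simpa [add_comm] using ha.add_one) ?_ ?_ ?_ ?_
    all_goals
      intro L i hL
      obtain ⟨k, rfl⟩ : ∃ k, L = l' + k := ⟨L - l', by omega⟩
      simp only [Nat.add_sub_cancel_left]
    · convert hM (k + 1) i using 1
      ring
    · have := hgl (k + 1 + i + 1)
      rw [show l' + k + i + 2 = l' + (k + 1 + i + 1) by ring]
      simp only [hA]
      linarith
    · have h4 := hgl' (k + 1 + i + 1)
      have h5 : ((1 : ℝ) / 2) ^ (l' + (k + 1 + i + 1)) ≤ (1 / 2) ^ (l' + k + 2) :=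
        pow_le_pow_of_le_one (by norm_num) (by norm_num) (by omega)
      rw [show l' + k + i + 2 = l' + (k + 1 + i + 1) by ring]
      have h6 := hpow (l' + k)
      rw [pow_add _ (l' + k)] at h5
      simp only [hA]
      linarith
    · have h4 := hgl' (k + 1)
      have h5 : ((1 : ℝ) / 2) ^ (l' + k) ≤ (1 / 2) ^ l :=
        pow_le_pow_of_le_one (by norm_num) (by norm_num) hL
      rw [← add_assoc, pow_succ _ (l' + k)] at h4
      simp only [hA]
      linarith
  | @limit o f a l e p e' ho ha hp h2 h3 he ih =>
    refine limit (fun l' i => 1 + p l' i) (fun l' i => (1 / 2) ^ (l' + i + 2))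
      (fundamentalSequence_oadd_one_of_limit ho) (by simpa [add_comm] using ha.add_one)
      (fun l' i hl' => ih l' i hl' (by omega)) (fun l' i hl' => ?_) (fun l' i hl' => ?_)
      (fun l' i hl' => ?_)
    · linarith [h2 l' i hl']
    · linarith [h3 l' i hl']
    · have : ((1 : ℝ) / 2) ^ l' ≤ (1 / 2) ^ l :=
        pow_le_pow_of_le_one (by norm_num) (by norm_num) hl'
      linarith [h3 l' i hl']

end Rank

theorem rank_omegaTower (k : ℕ) {l : ℕ} (hl : 1 ≤ l) :
    Rank (omegaTower k) (k + 1) l ((1 / 2) ^ l) := by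
  induction k with
  | zero =>
    have := Rank.oadd_one hl (Rank.zero (o := 0) (l := l) rfl Fusible.zero le_rfl)
    rw [add_zero] at this
    rw [Nat.cast_zero, zero_add]
    exact this
  | succ k ih =>
    have := ih.oadd_one hl
    rw [add_comm (1 : ℝ)] at this
    rw [Nat.cast_succ]
    exact this

/-- Just below `1 + a` there are long chains if `a` has large rank. If the rank is `β + 1`,
witnessed by `p < a`, then the chains for `β` just below `1 + p` are copied, by repeatedly fusing
with `a`, to between consecutive terms of a sequence that converges to `1 + a`; these copies are
concatenated, which iterates `wainer β`. The linear form `2 * N + 2` of the parameter leaves room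
for starting this iteration: `Chain.doubling` comes first, to make up for what is lost by
passing to the small scale `2⁻ᴺ`. -/
theorem Rank.chain {o : ONote} {a e : ℝ} {l : ℕ} (h : Rank o a l e) (hl : 1 ≤ l) {N : ℕ}
    (hN : 1 ≤ N) :
    Chain (1 + a) (2 * N + 2 + l) (1 + a - (1 / 2) ^ l) (2 * wainer o N + 2 + l) := by
  induction h generalizing N with
  | @zero o a l e ho ha he =>
    rw [wainer_zero ho]
    exact (Chain.doubling ha (2 * N + 2) l).mono le_rfl (by omega)
  | @succ o β a p l l' e e' ho ha h1 hl' hp h2 h3 he ih =>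
    have hpow : ∀ n, (0 : ℝ) < (1 / 2) ^ n := fun n => by positivity
    have hpow1 : ∀ n, ((1 : ℝ) / 2) ^ n ≤ 1 := fun n => pow_le_one₀ (by norm_num) (by norm_num)
    have hlt := lt_wainer o hN
    rw [wainer_succ ho] at hlt ⊢
    set g := a - p with hg
    have hg1 : g < 1 := h3.trans_le (two_mul_half_pow_le h1)
    have hg0 : 0 < g := (hpow l').trans_le h2
    set A : ℕ → ℝ := fun j => 1 + a - g * (1 / 2) ^ j with hA
    have hgl : ∀ j, (1 / 2) ^ (l' + j) ≤ g * (1 / 2) ^ j := fun j => by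
      rw [pow_add]
      exact mul_le_mul_of_nonneg_right h2 (hpow j).le
    have hgg : ∀ j, 0 < g * (1 / 2) ^ j ∧ g * (1 / 2) ^ j < 1 := fun j =>
      ⟨mul_pos hg0 (hpow j), (mul_le_of_le_one_right hg0.le (hpow1 j)).trans_lt hg1⟩
    have hAA : ∀ j, A (j + 1) = (a + A j + 1) / 2 := fun j => by
      simp only [hA, pow_succ]
      ring
    -- The chain just below `1 + p`, scaled by fusing it `j` times with `a`.
    have hC : ∀ x, 1 ≤ x → ∀ j, Chain (A j) (2 * x + 2 + (l' + j)) (A j - (1 / 2) ^ (l' + j))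
        (2 * wainer β x + 2 + (l' + j)) := by
      intro x hx j
      induction j with
      | zero =>
        have hA0 : A 0 = 1 + p := by simp only [hA, hg]; ring
        rw [hA0]
        exact ih h1 hx
      | succ j ihj =>
        have h5 := hpow1 (l' + j)
        have h6 := hgg j
        have := ihj.fuse ha (by simp only [hA]; linarith) (by simp only [hA]; linarith)
        have hq : (a + (A j - (1 / 2) ^ (l' + j)) + 1) / 2 =
            A (j + 1) - (1 / 2) ^ (l' + (j + 1)) := by
          rw [hAA, ← add_assoc l', pow_succ]
          ring
        rw [← hAA, hq] at this
        exact this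
    have hAf : ∀ j, Fusible (A j) := fun j => (hC 1 le_rfl j).fusible_left
    -- Concatenated over `n` consecutive terms of the sequence.
    have hI : ∀ n x j, 1 ≤ x → Chain (A (j + n)) (2 * x + 2 + (l' + (j + n))) (A j)
        (2 * (wainer β)^[n] x + 2 + (l' + j)) := by
      intro n
      induction n with
      | zero => exact fun x j _ => Chain.refl (hAf j) le_rfl
      | succ n ihn =>
        intro x j hx
        have hlt := lt_wainer β hx
        have h5 := hgl (j + n + 1)
        have h6 := hgg (j + n)
        have h7 := hgg (j + n + 1)
        have h8 : g * (1 / 2) ^ (j + n + 1) = g * (1 / 2) ^ (j + n) / 2 := by rw [pow_succ]; ring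
        refine ((hC x hx (j + n + 1)).lower (by omega) (hAf (j + n)) ?_ ?_).trans
          ((ihn (wainer β x) j (by omega)).mono (by omega) le_rfl) <;>
        · simp only [hA]
          linarith
    obtain ⟨k, rfl⟩ : ∃ k, l = l' + k := ⟨l - l', by omega⟩
    have h5 := hgl (k + 1 + N)
    have h6 := hgg (k + 1 + N)
    have h7 : ((1 : ℝ) / 2) ^ (N + (l' + k) + 2) ≤ (1 / 2) ^ (l' + (k + 1 + N)) :=
      pow_le_pow_of_le_one (by norm_num) (by norm_num) (by omega)
    have hstart := ((Chain.doubling ha N (N + (l' + k) + 2)).lower (by omega) (hAf (k + 1 + N))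
      (by simp only [hA]; linarith) (by simp only [hA]; linarith))
    have h8 : g * (1 / 2) ^ (k + 1) ≤ (1 / 2) ^ (l' + k) := by
      have := mul_le_mul_of_nonneg_right h3.le (hpow k).le
      rw [pow_succ, pow_add]
      linarith
    refine ((hstart.mono (by omega) le_rfl).trans ((hI N N (k + 1) hN).mono (by omega) ?_)).lower
      (by omega) (ha.add_one_sub_pow _) (by simp only [hA]; linarith)
      (by linarith [hpow1 (l' + k)])
    omega
  | @limit o f a l e p e' ho ha hp h2 h3 he ih =>
    obtain ⟨i, rfl⟩ : ∃ i, N = i + 1 := ⟨N - 1, by omega⟩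
    have hlt := lt_wainer o hN
    rw [wainer_limit ho] at hlt ⊢
    simp only [Nat.add_sub_cancel] at hlt ⊢
    have h4 := h2 l i le_rfl
    have h5 := h3 l i le_rfl
    have h6 : ((1 : ℝ) / 2) ^ l ≤ 1 := pow_le_one₀ (by norm_num) (by norm_num)
    have h7 : (0 : ℝ) < (1 / 2) ^ (l + i + 2) := by positivity
    have hpf : Fusible (1 + p l i) := by simpa [add_comm] using (hp l i le_rfl).fusible.add_one
    have hstart := (Chain.doubling ha (i + 2) (l + i + 2)).lower (by omega) hpf
      (by linarith) (by linarith)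
    exact ((hstart.mono (by omega) le_rfl).trans
      ((ih l i le_rfl (by omega) hN).mono (by omega) le_rfl)).mono le_rfl (by omega) |>.lower
      (by omega) (ha.add_one_sub_pow _) (by linarith) (by linarith)

/-! ### Successors of fusible numbers -/

/-- Fusible numbers do not accumulate from above. A least point `L` of accumulation from above would
exist; fusible numbers `z = (x + y + 1) / 2` with `x ≤ y` tending to `L` from above give a
limit `(c, d)` of the pairs `(x, y)`. Either `c, d < L`, so that `x ≤ c` and `y ≤ d` for `z` close
to `L`, or `d = L = c + 1`, so that `x ≤ c` and `y < x + 1` for `z` close to `L`. In both cases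
`z ≤ L`. -/
theorem exists_gap_right (x : ℝ) : ∃ ε > 0, ∀ z, Fusible z → x < z → x + ε ≤ z := by
  by_contra! hx
  set S : Set ℝ := {l | ∀ ε > 0, ∃ z, Fusible z ∧ l < z ∧ z < l + ε} with hS
  have hne : S.Nonempty := ⟨x, fun ε hε => hx ε hε⟩
  have hS0 : ∀ l ∈ S, 0 ≤ l := fun l hl => by
    by_contra! h0
    obtain ⟨z, hz, h1, h2⟩ := hl (-l) (by linarith)
    linarith [hz.nonneg]
  have hbdd : BddBelow S := ⟨0, hS0⟩
  set L := sInf S with hL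
  have hmem : ∀ ε > 0, ∃ z, Fusible z ∧ L < z ∧ z < L + ε := by
    intro ε hε
    obtain ⟨l, hl, hlt⟩ := exists_lt_of_csInf_lt hne (show sInf S < L + ε by linarith)
    have hLl : L ≤ l := csInf_le hbdd hl
    obtain ⟨z, hz, h1, h2⟩ := hl (L + ε - l) (by linarith)
    exact ⟨z, hz, by linarith, by linarith⟩
  have hbelow : ∀ c, c < L → ∃ ε > 0, ∀ z, Fusible z → z < c + ε → z ≤ c := by
    intro c hc
    have : c ∉ S := fun h => not_lt.2 (csInf_le hbdd h) hc
    simp only [hS, Set.mem_ofPred_eq] at this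
    push Not at this
    obtain ⟨ε, hε, h⟩ := this
    exact ⟨ε, hε, fun z hz h1 => not_lt.1 fun h2 => absurd (h z hz h2) (not_le.2 h1)⟩
  have hL0 : 0 ≤ L := le_csInf hne hS0
  have hpair : ∀ n : ℕ, ∃ q : ℝ × ℝ, Fusible q.1 ∧ Fusible q.2 ∧ q.1 ≤ q.2 ∧ q.2 < q.1 + 1 ∧
      2 * L < q.1 + q.2 + 1 ∧ q.1 + q.2 + 1 < 2 * (L + 1 / ((n : ℝ) + 1)) := by
    intro n
    obtain ⟨z, hz, h1, h2⟩ := hmem (1 / ((n : ℝ) + 1)) (by positivity)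
    cases hz with
    | zero => linarith
    | fuse x y hx hy hxy =>
      rw [abs_lt] at hxy
      rcases le_total x y with h | h
      · exact ⟨(x, y), hx, hy, h, by linarith, by linarith, by linarith⟩
      · exact ⟨(y, x), hy, hx, h, by linarith, by linarith, by linarith⟩
  choose q hq1 hq2 hle hlt hgt hnear using hpair
  have hbox : ∀ n, q n ∈ Set.Icc ((0 : ℝ), (0 : ℝ)) (2 * L + 2, 2 * L + 2) := by
    intro n
    have h1 : 1 / ((n : ℝ) + 1) ≤ 1 := by
      rw [div_le_one (by positivity)]
      linarith [(Nat.cast_nonneg n : (0 : ℝ) ≤ n)]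
    have h2 := (hq1 n).nonneg
    have h3 := (hq2 n).nonneg
    have h4 := hnear n
    exact ⟨⟨h2, h3⟩, ⟨by dsimp only; linarith, by dsimp only; linarith⟩⟩
  obtain ⟨⟨c, d⟩, _, φ, hφ, hlim⟩ := isCompact_Icc.tendsto_subseq hbox
  have hc : Tendsto (fun n => (q (φ n)).1) atTop (𝓝 c) :=
    (continuous_fst.tendsto (c, d)).comp hlim
  have hd : Tendsto (fun n => (q (φ n)).2) atTop (𝓝 d) :=
    (continuous_snd.tendsto (c, d)).comp hlim
  have hcd : c ≤ d := le_of_tendsto_of_tendsto' hc hd fun n => hle _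
  have hdc : d ≤ c + 1 := le_of_tendsto_of_tendsto' hd (hc.add_const 1) fun n => (hlt _).le
  have hsum : c + d + 1 ≤ 2 * L := by
    have hr : Tendsto (fun n => 2 * (L + 1 / ((φ n : ℝ) + 1))) atTop (𝓝 (2 * (L + 0))) :=
      ((tendsto_one_div_add_atTop_nhds_zero_nat.comp hφ.tendsto_atTop).const_add L).const_mul 2
    rw [add_zero] at hr
    exact le_of_tendsto_of_tendsto' ((hc.add hd).add_const 1) hr fun n => (hnear _).le
  obtain ⟨ε, hε, hcε⟩ := hbelow c (by linarith)
  have hxc : ∀ᶠ n in atTop, (q (φ n)).1 ≤ c := by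
    filter_upwards [hc.eventually_lt_const (show c < c + ε by linarith)] with n hn
    exact hcε _ (hq1 _) hn
  rcases lt_or_ge d L with hdL | hdL
  · obtain ⟨ε', hε', hdε⟩ := hbelow d hdL
    have hyd : ∀ᶠ n in atTop, (q (φ n)).2 ≤ d := by
      filter_upwards [hd.eventually_lt_const (show d < d + ε' by linarith)] with n hn
      exact hdε _ (hq2 _) hn
    obtain ⟨n, h1, h2⟩ := (hxc.and hyd).exists
    linarith [hgt (φ n)]
  · obtain ⟨n, h1⟩ := hxc.exists
    linarith [hgt (φ n), hlt (φ n)]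

theorem exists_next_fusible (x : ℝ) :
    ∃ y, Fusible y ∧ x < y ∧ ∀ z, Fusible z → ¬ (x < z ∧ z < y) := by
  set S : Set ℝ := {z | Fusible z ∧ x < z} with hS
  have hne : S.Nonempty := by
    obtain ⟨n, hn⟩ := exists_nat_gt x
    exact ⟨n, by simpa using Fusible.zero.add_nat n, hn⟩
  have hbdd : BddBelow S := ⟨x, fun z hz => hz.2.le⟩
  obtain ⟨ε', hε', hgap'⟩ := exists_gap_right (sInf S)
  obtain ⟨y, hy, hlt⟩ := exists_lt_of_csInf_lt hne (show sInf S < sInf S + ε' by linarith)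
  have hyS : sInf S = y := le_antisymm (csInf_le hbdd hy) <| not_lt.1 fun h => by
    linarith [hgap' y hy.1 h]
  refine ⟨y, hy.1, hy.2, fun z hz h => ?_⟩
  have := csInf_le hbdd (show z ∈ S from ⟨hz, h.1⟩)
  linarith [h.2]

/-! ### The largest gap -/

/-- The rank of `k + 1` gives a long chain just below `k + 2`, which makes fusible numbers dense just
below `k + 6`; from `x` one descends to that place. -/
theorem near_of_wainerEpsilonZero {k : ℕ} (hk : 1 ≤ k) {x : ℝ} (hx : (k : ℝ) + 7 ≤ x) :
    Near x ((1 / 2) ^ wainerEpsilonZero k) := by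
  have hpow : ((1 : ℝ) / 2) * (1 / 4) ^ (k + 5) ≤ (1 / 2) ^ (2 * k + 2 + 1 + 2) := by
    rw [show ((1 : ℝ) / 4) = (1 / 2) ^ 2 by norm_num, ← pow_mul, ← pow_succ']
    exact pow_le_pow_of_le_one (by norm_num) (by norm_num) (by omega)
  obtain ⟨u, hu, huk, hd⟩ := exists_dom_sub (x := x) (r := k + 6)
    (δ := (1 / 2) * (1 / 4) ^ (k + 5)) (by linarith)
    (hpow.trans (pow_le_one₀ (by norm_num) (by norm_num)))
    fun t ht _ => near_quarter_pow (by push_cast; linarith)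
  have hc := (rank_omegaTower k le_rfl).chain le_rfl hk
  obtain ⟨v, hv, hvF, hd'⟩ := hc.exists_dom hu (huk.trans hpow)
  rw [show (4 : ℝ) + (1 + (k + 1)) - u = k + 6 - u by ring] at hd'
  refine (hd _ (hd' v ⟨_, hc.fusible_right.add_nat 4, ?_, ?_⟩)).mono
    (hvF.trans (pow_le_pow_of_le_one (by norm_num) (by norm_num) ?_)) <;>
    push_cast
  · linarith
  · linarith
  · rw [wainerEpsilonZero]
    omega

theorem le_of_mem_fusibleGaps {n : ℕ} {δ ε : ℝ} (hδ : δ ∈ fusibleGaps n)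
    (h : ∀ x, (n : ℝ) ≤ x → Near x ε) : δ ≤ ε := by
  obtain ⟨x, y, _, _, hnx, _, hcons, rfl⟩ := hδ
  obtain ⟨z, hz, h1, h2⟩ := h x hnx
  have : y ≤ z := not_lt.1 fun h3 => hcons z hz ⟨h1, h3⟩
  linarith

/-- Gaps not smaller than a given one start in a bounded interval and do not overlap, so there are
finitely many. -/
theorem exists_isGreatest_fusibleGaps (n : ℕ) : ∃ g, IsGreatest (fusibleGaps n) g := by
  obtain ⟨y, hy, hny, hcons⟩ := exists_next_fusible n
  set δ := y - n with hδ
  have hδ0 : 0 < δ := by linarith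
  have hmem : δ ∈ fusibleGaps n :=
    ⟨n, y, by simpa using Fusible.zero.add_nat n, hy, le_rfl, hny, hcons, rfl⟩
  obtain ⟨j, hj⟩ := exists_pow_lt_of_lt_one hδ0 (by norm_num : (1 : ℝ) / 4 < 1)
  set X : Set ℝ := {x | ∃ y, Fusible x ∧ Fusible y ∧ (n : ℝ) ≤ x ∧ x < y ∧
    (∀ z, Fusible z → ¬ (x < z ∧ z < y)) ∧ δ ≤ y - x} with hX
  have hXj : ∀ x ∈ X, x < j := by
    rintro x ⟨y, _, _, _, _, hcons, hxy⟩
    by_contra! hjx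
    obtain ⟨z, hz, h1, h2⟩ := near_quarter_pow hjx
    have : y ≤ z := not_lt.1 fun h3 => hcons z hz ⟨h1, h3⟩
    have : (0 : ℝ) < (1 / 4) ^ j := by positivity
    linarith
  have hfin : X.Finite := by
    refine Set.Finite.of_finite_image (f := fun x => ⌊(x - n) / δ⌋₊)
      ((Set.finite_Iic ⌊(j - n : ℝ) / δ⌋₊).subset ?_) ?_
    · rintro _ ⟨x, hx, rfl⟩
      exact Nat.floor_le_floor (by have := hXj x hx; gcongr)
    · have key : ∀ x ∈ X, ∀ x' ∈ X, x < x' → ⌊(x - n) / δ⌋₊ ≠ ⌊(x' - n) / δ⌋₊ := by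
        rintro x ⟨y, _, _, hnx, _, hcons, hxy⟩ x' ⟨_, hx', _⟩ hlt
        have hyx' : y ≤ x' := not_lt.1 fun h => hcons x' hx' ⟨hlt, h⟩
        have h1 : (x - n) / δ + 1 ≤ (x' - n) / δ := by
          rw [div_add_one hδ0.ne']
          gcongr
          linarith
        have h2 := Nat.floor_le_floor h1
        rw [Nat.floor_add_one (div_nonneg (by linarith) hδ0.le)] at h2
        omega
      intro x hx x' hx' h
      rcases lt_trichotomy x x' with h1 | h1 | h1
      · exact absurd h (key x hx x' hx' h1)
      · exact h1
      · exact absurd h.symm (key x' hx' x hx h1)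
  have hgfin : {ε | ε ∈ fusibleGaps n ∧ δ ≤ ε}.Finite := by
    choose! next hnext using exists_next_fusible
    refine (hfin.image fun x => next x - x).subset ?_
    rintro ε ⟨⟨x, y, hx, hy, hnx, hxy, hcons, rfl⟩, hle⟩
    refine ⟨x, ⟨y, hx, hy, hnx, hxy, hcons, hle⟩, ?_⟩
    obtain ⟨h1, h2, h3⟩ := hnext x
    have h4 : y ≤ next x := not_lt.1 fun h => hcons _ h1 ⟨h2, h⟩
    have h5 : next x ≤ y := not_lt.1 fun h => h3 y hy ⟨hxy, h⟩
    simp only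
    linarith
  obtain ⟨g, hg, hmax⟩ := hgfin.exists_maximal ⟨δ, hmem, le_rfl⟩
  refine ⟨g, hg.1, fun ε hε => ?_⟩
  rcases le_total ε g with h | h
  · exact h
  · exact hmax ⟨hε, hg.2.trans h⟩ h

theorem theorem2 :
    ∃ g : ℕ → ℝ, (∀ n : ℕ, IsGreatest (fusibleGaps n) (g n)) ∧
      ∀ n : ℕ, 8 ≤ n → (wainerEpsilonZero (n - 7) : ℝ) ≤ (g n)⁻¹ := by
  choose g hg using exists_isGreatest_fusibleGaps
  refine ⟨g, hg, fun n hn => ?_⟩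
  obtain ⟨k, rfl⟩ : ∃ k, n = k + 7 := ⟨n - 7, by omega⟩
  rw [Nat.add_sub_cancel]
  have hle := le_of_mem_fusibleGaps (hg (k + 7)).1 fun x hx =>
    near_of_wainerEpsilonZero (k := k) (by omega) (by push_cast at hx; exact hx)
  have hpos : 0 < g (k + 7) := by
    obtain ⟨x, y, _, _, _, hxy, _, h⟩ := (hg (k + 7)).1
    linarith
  rw [le_inv_comm₀ (by
    have := lt_wainer (omegaTower k) (n := k) (by omega)
    exact_mod_cast (by rw [wainerEpsilonZero]; omega : 0 < wainerEpsilonZero k)) hpos]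
  refine hle.trans ?_
  rw [one_div, inv_pow]
  gcongr
  · have := lt_wainer (omegaTower k) (n := k) (by omega)
    exact_mod_cast (by rw [wainerEpsilonZero]; omega : 0 < wainerEpsilonZero k)
  · exact_mod_cast Nat.lt_two_pow_self.le
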